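/- Define functions $G_l$ recursively by $G_1=1$ and, for $l\ge 1$, $$G_{l+1}(s,y)=\int_0^s \frac{G_l(1,t)}{1-ty}\,dt\ \ (l \text{ odd}),\qquad G_{l+1}(s,y)=\int_0^s \frac{ty\,G_l(1,t)}{1-ty}\,dt\ \ (l\text{ even}),$$ where $G_1(1,t)=1$. (So $G_2(1,y)=-\log(1-y)/y$.) For integers $m_1,\dots,m_{r-1}\ge 1$, $m_r\ge 2$ let $\zeta(m_1,\dots,m_r)=\sum_{0<k_1<\dots<k_r}k_1^{-m_1}\cdots k_r^{-m_r}$. A word $[i_1|\dots|i_w]$ in the letters $0,1$ is called admissible if $i_k=1$ for all $k\equiv w \pmod 2$. Let $\psi_0=1$ and, for $n\ge 1$, let $\psi_{2n}$ be the sum of all $\zeta(m_1,\dots,m_r)$ such that $m_1+\dots+m_r=2n$, $m_r=2$, $1\le m_k\le 2$ for $1\le k\le r-1$, and the word $[0^{m_r-1}|1|\dots|0^{m_1-1}|1]$ is admissible (equivalently, $(m_1,\dots,m_r)$ is a concatenation of blocks $(2)$ and $(1,1)$, the last block being $(2)$). Define $\beta^{(l+1)}_m$ for $l\ge 1$, $1\le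 m\le l$, by $\beta^{(2)}_1=1$ and, for $l\ge 2$, $$\beta^{(l+1)}_m=\sum_{\substack{0\le n\le l-m\\ n\text{ even}}}\psi_n\,\beta^{(l)}_{m-1+n}\quad\text{if } m\equiv l \pmod 2,\qquad \beta^{(l+1)}_m=0\quad\text{if } m\not\equiv l\pmod 2,$$ with the convention $\beta^{(l)}_0=0$. Then for every $l\ge 1$ the function $x\mapsto G_{l+1}(1,x)$ is integrable on $[0,1]$ and $$\int_0^1 G_{l+1}(1,x)\,dx=\begin{cases}\displaystyle\sum_{\substack{1\le m\le l\\ m\text{ odd}}}\beta^{(l+1)}_m\,\psi_{m+1} & \text{if } l \text{ is odd},\\[2ex] \beta^{(l+2)}_1 & \text{if } l\text{ is even}.\end{cases}$$ -/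

import Mathlib

namespace XiIntegrals

/-- The kernel of the step from `G_l` to `G_{l+1}`: it is `1 / (1 - t y)` if `l` is odd and
`t y / (1 - t y)` if `l` is even. -/
noncomputable def kernel (l : ℕ) (t y : ℝ) : ℝ :=
  (if Odd l then 1 else t * y) / (1 - t * y)

/-- `G l s y` is `G_l(s, y)`: one has `G_1 = 1`, and `G_{l+1}(s, y)` is the primitive in `s`,
vanishing at `s = 0`, of `s ↦ kernel l s y * G_l(1, s)`. The index `0` is not used. -/
noncomputable def G : ℕ → ℝ → ℝ → ℝ
  | 0, _, _ => 0
  | 1, _, _ => 1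
  | l + 2, s, y => ∫ t in (0 : ℝ)..s, kernel (l + 1) t y * G (l + 1) 1 t

/-- The multiple zeta value `ζ(m_1, …, m_r)`, the sum of `1 / (k_1 ^ m_1 ⋯ k_r ^ m_r)` over all
integers `0 < k_1 < ⋯ < k_r` (it converges when all `m_j ≥ 1` and `m_r ≥ 2`). -/
noncomputable def mzv (m : List ℕ) : ℝ :=
  ∑' k : {k : Fin m.length → ℕ // StrictMono k ∧ ∀ j, 0 < k j},
    ∏ j : Fin m.length, 1 / (k.1 j : ℝ) ^ m.get j

/-- The word `[0^{m_r - 1} | 1 | ⋯ | 0^{m_1 - 1} | 1]` attached to `(m_1, …, m_r)`. -/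
def word (m : List ℕ) : List (Fin 2) :=
  m.reverse.flatMap fun a => List.replicate (a - 1) 0 ++ [1]

/-- A word `i = [i_1 | ⋯ | i_w]` of weight `w` is admissible if `i_k = 1` for all `1 ≤ k ≤ w` with
`k ≡ w` modulo `2`. (The `k`-th letter in the usual counting from `1` has list index `k - 1`.) -/
def IsAdmissible (i : List (Fin 2)) : Prop :=
  ∀ k : Fin i.length, (k : ℕ) + 1 ≡ i.length [MOD 2] → i.get k = 1

open Classical in
/-- `ψ_n` (for even `n`; odd indices are never used): `ψ_0 = 1`, and for even `n ≥ 2` it is the sum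
of the multiple zeta values `ζ(m_1, …, m_r)` over all `(m_1, …, m_r)` with `m_1 + ⋯ + m_r = n`,
`m_r = 2`, `1 ≤ m_k ≤ 2` for all `k`, whose word is admissible. -/
noncomputable def psi (n : ℕ) : ℝ :=
  if n = 0 then 1
  else ∑ c : Composition n with
      c.blocks.getLast? = some 2 ∧ (∀ a ∈ c.blocks, a ≤ 2) ∧ IsAdmissible (word c.blocks),
    mzv c.blocks

/-- `beta l m` is `β^{(l)}_m`. The numbers are determined by `β^{(2)}_1 = 1` and
`β^{(l+1)}_m = ∑_{n even, 0 ≤ n ≤ l - m} ψ_n β^{(l)}_{m-1+n}` for `l ≥ 2`, `1 ≤ m ≤ l`,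
`m ≡ l` modulo `2`; all other `β^{(l+1)}_m` are zero. -/
noncomputable def beta : ℕ → ℕ → ℝ
  | 0, _ => 0
  | 1, _ => 0
  | 2, m => if m = 1 then 1 else 0
  | l + 3, m =>
    if 1 ≤ m ∧ m ≤ l + 2 ∧ m ≡ l + 2 [MOD 2] then
      ∑ n ∈ Finset.range (l + 2 - m + 1) with Even n, psi n * beta (l + 2) (m - 1 + n)
    else 0

end XiIntegrals

open Filter Topology

namespace XiIntegrals

/-! Expanding `1 / (1 - t y)` geometrically turns the recursion for `G` into linear algebra. The
power series coefficients of `G (l + 2) 1` are moments of `G (l + 1) 1`. Once exponents are shifted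
by the order of the kernel, each moment vector is the image of the previous one under the matrix `1
/ (j + k + 2)`, for both parities of `l`; the initial vector is `1 / (k + 1)` (`G_moments`).

This matrix is triangular on the nested sums `harm m`, up to raising `m` by one. Summation by parts
shows that `k ↦ hilb m (k + 1)` obeys the same kind of first-order difference equation as `harm (m +
1)`; the constants of summation are the values `hilb m 0` with `m` even (`hilb_succ_eq_sum`). Those
constants are the `psi (m + 2)`, because the blocks `(2)` and `(1,1)` supply the cases `=` and `<`
of an inequality `≤` (`psi_eq_hilb`). Reading off coefficients gives the recursion of `beta`
(`hasSum_moment_succ`).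

The final integral pairs a moment vector with `1 / (j + 1)` or `1 / (j + 2)`. The first pairing
yields the values `psi (m + 1)`; the second is the entry `k = 0` of the next moment vector, where
only `harm 0` contributes. -/

/-! ### Nested harmonic sums and their decay. -/

/-- Nested harmonic sums: `(k + 1) * harm m k` is the sum of `1 / (k_1 ⋯ k_m)` over all chains
`k_1 ≤ k_2 < k_3 ≤ ⋯` of positive integers, continued to `k + 1` by the next inequality sign. -/
noncomputable def harm : ℕ → ℕ → ℝ
  | 0, k => 1 / ((k : ℝ) + 1)
  | m + 1, k => (∑ j ∈ Finset.range (k + if Even m then 1 else 0), harm m j) / ((k : ℝ) + 1)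

theorem harm_nonneg (m k : ℕ) : 0 ≤ harm m k := by
  induction m generalizing k with
  | zero => simp only [harm]; positivity
  | succ m ih =>
    simp only [harm]
    exact div_nonneg (Finset.sum_nonneg fun j _ => ih j) (by positivity)

theorem sum_inv_sqrt_le (n : ℕ) :
    ∑ j ∈ Finset.range n, 1 / √((j : ℝ) + 1) ≤ 2 * √(n : ℝ) := by
  induction n with
  | zero => simp
  | succ n ih =>
    rw [Finset.sum_range_succ]
    have h1 : (0 : ℝ) < √((n : ℝ) + 1) := by positivity
    have h2 : √((n : ℝ) + 1) ^ 2 = n + 1 := Real.sq_sqrt (by positivity)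
    have h3 : √(n : ℝ) ^ 2 = n := Real.sq_sqrt (by positivity)
    have h4 : 1 / √((n : ℝ) + 1) ≤ 2 * √((n : ℝ) + 1) - 2 * √(n : ℝ) := by
      rw [div_le_iff₀ h1]
      nlinarith [sq_nonneg (√((n : ℝ) + 1) - √(n : ℝ))]
    push_cast
    linarith

/-- A crude bound, but the factor `(k + 1) ^ (-1/2)` reproduces itself under the recursion and
suffices for the convergence of `hilb` and for vanishing boundary terms. -/
theorem harm_le (m k : ℕ) : harm m k ≤ 2 ^ m * (1 / √((k : ℝ) + 1)) := by
  induction m generalizing k with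
  | zero =>
    simp only [harm, pow_zero, one_mul]
    apply one_div_le_one_div_of_le (by positivity)
    rw [Real.sqrt_le_left (by positivity)]
    have : (0 : ℝ) ≤ k := by positivity
    nlinarith
  | succ m ih =>
    simp only [harm]
    have h1 : ∑ j ∈ Finset.range (k + if Even m then 1 else 0), harm m j
        ≤ ∑ j ∈ Finset.range (k + 1), harm m j := by
      apply Finset.sum_le_sum_of_subset_of_nonneg
      · intro j
        simp only [Finset.mem_range]
        split_ifs <;> omega
      · intro j _ _
        exact harm_nonneg m j
    have h2 : ∑ j ∈ Finset.range (k + 1), harm m j ≤ 2 ^ m * (2 * √((k : ℝ) + 1)) := by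
      refine (Finset.sum_le_sum fun j _ => ih j).trans ?_
      rw [← Finset.mul_sum]
      have := sum_inv_sqrt_le (k + 1)
      push_cast at this
      gcongr
    have h3 : √((k : ℝ) + 1) * √((k : ℝ) + 1) = k + 1 := Real.mul_self_sqrt (by positivity)
    have h4 : (0 : ℝ) < √((k : ℝ) + 1) := by positivity
    rw [div_le_iff₀ (by positivity)]
    calc _ ≤ 2 ^ m * (2 * √((k : ℝ) + 1)) := h1.trans h2
      _ = 2 ^ (m + 1) * (1 / √((k : ℝ) + 1)) * (√((k : ℝ) + 1) * √((k : ℝ) + 1)) := by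
        field_simp
        ring
      _ = _ := by rw [h3]

theorem harm_tendsto (m : ℕ) : Tendsto (harm m) atTop (𝓝 0) := by
  have h : Tendsto (fun k : ℕ => 2 ^ m * (1 / √((k : ℝ) + 1))) atTop (𝓝 (2 ^ m * 0)) := by
    apply Tendsto.const_mul
    apply Tendsto.comp (g := fun x : ℝ => 1 / x) (f := fun k : ℕ => √((k : ℝ) + 1))
    · simpa using tendsto_inv_atTop_zero (𝕜 := ℝ)
    · exact Real.tendsto_sqrt_atTop.comp
        (tendsto_atTop_add_const_right _ _ tendsto_natCast_atTop_atTop)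
  rw [mul_zero] at h
  exact squeeze_zero (harm_nonneg m) (harm_le m) h

theorem summable_harm_div (m c : ℕ) : Summable fun j : ℕ => harm m j / ((j : ℝ) + 1 + c) := by
  have h : Summable fun j : ℕ => 2 ^ m * (1 / (((j + 1 : ℕ) : ℝ) ^ (3 / 2 : ℝ))) :=
    ((summable_nat_add_iff 1).2 (Real.summable_one_div_nat_rpow.2 (by norm_num))).mul_left _
  refine Summable.of_nonneg_of_le (fun j => div_nonneg (harm_nonneg m j) (by positivity))
    (fun j => ?_) h
  have h1 : ((j + 1 : ℕ) : ℝ) ^ (3 / 2 : ℝ) = √((j : ℝ) + 1) * ((j : ℝ) + 1) := by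
    rw [show (3 / 2 : ℝ) = 1 / 2 + 1 by norm_num, Real.rpow_add (by positivity), Real.rpow_one,
      ← Real.sqrt_eq_rpow]
    push_cast
    rfl
  rw [h1, ← one_div_mul_one_div, ← mul_assoc, mul_one_div]
  exact div_le_div₀ (by positivity) (harm_le m j) (by positivity) (by simp)

/-! ### Hilbert-type matrix acting on nested harmonic sums. -/

/-- The image of `harm m` under the matrix `1 / (j + k + 1)`. -/
noncomputable def hilb (m k : ℕ) : ℝ := ∑' j : ℕ, harm m j / ((j : ℝ) + 1 + k)

theorem hasSum_hilb (m k : ℕ) : HasSum (fun j : ℕ => harm m j / ((j : ℝ) + 1 + k)) (hilb m k) :=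
  (summable_harm_div m k).hasSum

theorem sum_div_by_parts (V : ℕ → ℝ) (hV : V 0 = 0) (c N : ℕ) :
    ∑ j ∈ Finset.range N, (V (j + 1) - V j) / ((j : ℝ) + 1 + c) =
      ∑ j ∈ Finset.range N, V (j + 1) * (1 / ((j : ℝ) + 1 + c) - 1 / ((j : ℝ) + 1 + (c + 1 : ℕ)))
        + V N / ((N : ℝ) + 1 + c) := by
  induction N with
  | zero => simp [hV]
  | succ N ih =>
    rw [Finset.sum_range_succ, Finset.sum_range_succ, ih]
    push_cast
    field_simp
    ring

/-- Abel summation, with `(k+1)/(j+k+2) - k/(j+k+1) = (j+1)/((j+k+1)(j+k+2))`. The boundary term is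
at most `harm m (N - 1)`, hence tends to zero. -/
theorem tendsto_sum_harm_diff (m k : ℕ) (V : ℕ → ℝ) (hV : V 0 = 0)
    (h : ∀ j : ℕ, V (j + 1) = ((j : ℝ) + 1) * harm m j) :
    Tendsto (fun N => ∑ j ∈ Finset.range N, (V (j + 1) - V j) / ((j : ℝ) + 1 + k)) atTop
      (𝓝 (((k : ℝ) + 1) * hilb m (k + 1) - k * hilb m k)) := by
  simp_rw [sum_div_by_parts V hV]
  rw [← add_zero (((k : ℝ) + 1) * hilb m (k + 1) - k * hilb m k)]
  apply Tendsto.add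
  · apply HasSum.tendsto_sum_nat
    have := ((hasSum_hilb m (k + 1)).mul_left ((k : ℝ) + 1)).sub
      ((hasSum_hilb m k).mul_left (k : ℝ))
    refine this.congr_fun fun j => ?_
    rw [h]
    push_cast
    field_simp
    ring
  · rw [← tendsto_add_atTop_iff_nat 1]
    refine squeeze_zero (fun N => ?_) (fun N => ?_) (harm_tendsto m)
    · rw [h]
      exact div_nonneg (mul_nonneg (by positivity) (harm_nonneg m N)) (by positivity)
    · rw [h, div_le_iff₀ (by positivity), mul_comm]
      apply mul_le_mul_of_nonneg_left _ (harm_nonneg m N)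
      push_cast
      linarith [(Nat.cast_nonneg k : (0 : ℝ) ≤ k)]

theorem hilb_zero_step (k : ℕ) :
    ((k : ℝ) + 1) * hilb 0 (k + 1) - k * hilb 0 k = 1 / ((k : ℝ) + 1) := by
  -- This `V` jumps only from `0` to `1`, so only the term `j = 0` of the sum survives.
  refine tendsto_nhds_unique (tendsto_sum_harm_diff 0 k (fun j => if j = 0 then 0 else 1) rfl
    (fun j => ?_)) ?_
  · have : ((j : ℝ) + 1) ≠ 0 := by positivity
    simp [harm, this]
  · rw [← tendsto_add_atTop_iff_nat 1]
    refine tendsto_const_nhds.congr fun N => ?_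
    rw [Finset.sum_range_succ']
    simp [add_comm]

theorem hilb_step_of_even {m : ℕ} (hm : Even m) (k : ℕ) :
    ((k : ℝ) + 1) * hilb (m + 1) (k + 1) - k * hilb (m + 1) k = hilb m k := by
  refine tendsto_nhds_unique (tendsto_sum_harm_diff (m + 1) k
    (fun j => ∑ i ∈ Finset.range j, harm m i) (by simp) (fun j => ?_)) ?_
  · simp only [harm, hm, if_true]
    field_simp
  · refine (hasSum_hilb m k).tendsto_sum_nat.congr fun N => Finset.sum_congr rfl fun j _ => ?_
    rw [Finset.sum_range_succ]
    ring

theorem hilb_step_of_odd {m : ℕ} (hm : Odd m) (k : ℕ) :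
    ((k : ℝ) + 1) * hilb (m + 1) (k + 1) - k * hilb (m + 1) k = hilb m (k + 1) := by
  have hm' : ¬ Even m := Nat.not_even_iff_odd.2 hm
  -- The strict inequality in `harm (m + 1)` delays `V` by one. Truncated subtraction makes the
  -- first difference zero, and reindexing replaces `k` by `k + 1`.
  refine tendsto_nhds_unique (tendsto_sum_harm_diff (m + 1) k
    (fun j => ∑ i ∈ Finset.range (j - 1), harm m i) (by simp) (fun j => ?_)) ?_
  · simp only [harm, hm', if_false, Nat.add_sub_cancel, Nat.add_zero]
    field_simp
  · rw [← tendsto_add_atTop_iff_nat 1]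
    refine (hasSum_hilb m (k + 1)).tendsto_sum_nat.congr fun N => ?_
    rw [Finset.sum_range_succ']
    simp only [Nat.add_sub_cancel, zero_add, Nat.zero_sub, sub_self, zero_div, add_zero]
    refine Finset.sum_congr rfl fun j _ => ?_
    rw [Finset.sum_range_succ]
    push_cast
    ring

theorem harm_step_of_even {m : ℕ} (hm : Even m) (k : ℕ) :
    ((k : ℝ) + 2) * harm (m + 1) (k + 1) - ((k : ℝ) + 1) * harm (m + 1) k = harm m (k + 1) := by
  simp only [harm, hm, if_true]
  rw [Finset.sum_range_succ _ (k + 1)]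
  push_cast
  field_simp
  ring

theorem harm_step_of_odd {m : ℕ} (hm : Odd m) (k : ℕ) :
    ((k : ℝ) + 2) * harm (m + 1) (k + 1) - ((k : ℝ) + 1) * harm (m + 1) k = harm m k := by
  have hm' : ¬ Even m := Nat.not_even_iff_odd.2 hm
  simp only [harm, hm', if_false, Nat.add_zero]
  rw [Finset.sum_range_succ _ k]
  push_cast
  field_simp
  ring

theorem harm_succ_zero_of_even {m : ℕ} (hm : Even m) : harm (m + 1) 0 = harm m 0 := by
  simp [harm, hm]

theorem harm_succ_zero_of_odd {m : ℕ} (hm : Odd m) : harm (m + 1) 0 = 0 := by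
  simp [harm, Nat.not_even_iff_odd.2 hm]

/-- The matrix `1 / (j + k + 2)` acts on the nested harmonic sums triangularly, up to a shift. -/
theorem hilb_succ_eq_sum (p : ℕ → ℝ) (hp0 : p 0 = 1)
    (hp : ∀ m, Even m → p (m + 2) = hilb m 0) (m k : ℕ) :
    hilb m (k + 1) = ∑ n ∈ Finset.range (m + 2) with Even n, p n * harm (m + 1 - n) k := by
  induction m generalizing k with
  | zero =>
    have hR : ∑ n ∈ Finset.range (0 + 2) with Even n, p n * harm (0 + 1 - n) k = harm 1 k := by
      rw [Finset.sum_filter]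
      simp [Finset.sum_range_succ, hp0]
    rw [hR]
    have key : ((k : ℝ) + 1) * hilb 0 (k + 1) = ((k : ℝ) + 1) * harm 1 k := by
      clear hR
      induction k with
      | zero => simpa [harm] using hilb_zero_step 0
      | succ k ih =>
        have h1 := hilb_zero_step (k + 1)
        have h2 := harm_step_of_even (m := 0) (by simp) k
        simp only [zero_add] at h2
        have h3 : harm 0 (k + 1) = 1 / (((k + 1 : ℕ) : ℝ) + 1) := rfl
        push_cast at h1 h3 ⊢
        linarith
    exact mul_left_cancel₀ (by positivity) key
  | succ m ih =>
    set R : ℕ → ℝ := fun k =>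
      ∑ n ∈ Finset.range (m + 1 + 2) with Even n, p n * harm (m + 1 + 1 - n) k with hR
    suffices key : ((k : ℝ) + 1) * hilb (m + 1) (k + 1) = ((k : ℝ) + 1) * R k from
      mul_left_cancel₀ (by positivity) key
    rcases Nat.even_or_odd m with hm | hm
    -- For even `m` the top index `n = m + 2` survives the filter. Its term is a multiple of `harm
    -- 0`, which the difference operator kills: it is the constant of summation, fixed at `k = 0`.
    · have hsplit : ∀ k, R k = p (m + 2) * harm 0 k +
          ∑ n ∈ Finset.range (m + 2) with Even n, p n * harm (m + 1 - n + 1) k := by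
        intro k
        simp only [hR, Finset.sum_filter]
        rw [Finset.sum_range_succ, if_pos (by grind), add_comm]
        congr 1
        · congr 2
          omega
        · refine Finset.sum_congr rfl fun n hn => ?_
          rw [Finset.mem_range] at hn
          rw [show m + 1 + 1 - n = m + 1 - n + 1 by omega]
      have hodd : ∀ n ∈ (Finset.range (m + 2)).filter Even, Odd (m + 1 - n) := by
        intro n hn
        simp only [Finset.mem_filter, Finset.mem_range] at hn
        grind
      induction k with
      | zero =>
        have h1 := hilb_step_of_even hm 0
        have h2 : R 0 = p (m + 2) := by
          rw [hsplit, Finset.sum_eq_zero]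
          · simp [harm]
          · intro n hn
            rw [harm_succ_zero_of_odd (hodd n hn), mul_zero]
        rw [h2, hp m hm, ← h1]
        simp
      | succ k ihk =>
        have h1 := hilb_step_of_even hm (k + 1)
        have h2 : ((k : ℝ) + 2) * R (k + 1) - ((k : ℝ) + 1) * R k = hilb m (k + 1) := by
          rw [ih, hsplit, hsplit, mul_add, mul_add, Finset.mul_sum, Finset.mul_sum,
            add_sub_add_comm, ← Finset.sum_sub_distrib]
          have h3 : ((k : ℝ) + 2) * (p (m + 2) * harm 0 (k + 1)) -
              ((k : ℝ) + 1) * (p (m + 2) * harm 0 k) = 0 := by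
            simp only [harm]
            push_cast
            field_simp
            ring
          rw [h3, zero_add]
          refine Finset.sum_congr rfl fun n hn => ?_
          rw [← harm_step_of_odd (hodd n hn) k]
          ring
        push_cast at h1 ⊢
        linarith
    -- For odd `m` the top index is filtered out, so no new constant appears.
    · have hsplit : ∀ k, R k =
          ∑ n ∈ Finset.range (m + 2) with Even n, p n * harm (m + 1 - n + 1) k := by
        intro k
        simp only [hR, Finset.sum_filter]
        rw [Finset.sum_range_succ, if_neg (by grind), add_zero]
        refine Finset.sum_congr rfl fun n hn => ?_
        rw [Finset.mem_range] at hn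
        rw [show m + 1 + 1 - n = m + 1 - n + 1 by omega]
      have heven : ∀ n ∈ (Finset.range (m + 2)).filter Even, Even (m + 1 - n) := by
        intro n hn
        simp only [Finset.mem_filter, Finset.mem_range] at hn
        grind
      induction k with
      | zero =>
        have h1 := hilb_step_of_odd hm 0
        have h2 : R 0 = hilb m (0 + 1) := by
          rw [hsplit, ih]
          refine Finset.sum_congr rfl fun n hn => ?_
          rw [harm_succ_zero_of_even (heven n hn)]
        rw [h2, ← h1]
        simp
      | succ k ihk =>
        have h1 := hilb_step_of_odd hm (k + 1)
        have h2 : ((k : ℝ) + 2) * R (k + 1) - ((k : ℝ) + 1) * R k = hilb m (k + 1 + 1) := by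
          rw [ih, hsplit, hsplit, Finset.mul_sum, Finset.mul_sum, ← Finset.sum_sub_distrib]
          refine Finset.sum_congr rfl fun n hn => ?_
          rw [← harm_step_of_even (heven n hn) k]
          ring
        push_cast at h1 ⊢
        linarith

/-! ### Multiple zeta values as iterated sums in `[0, ∞]`, where rearrangement needs no summability.
-/

open scoped ENNReal

open Classical in
/-- The multiple zeta value with exponents `a`, in `[0, ∞]`, truncated to indices below `N`. -/
noncomputable def mzvBelow {r : ℕ} (a : Fin r → ℕ) (N : ℕ∞) : ℝ≥0∞ :=
  ∑' k : Fin r → ℕ, if StrictMono k ∧ (∀ j, 0 < k j) ∧ ∀ j, (k j : ℕ∞) < N then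
    ∏ j, ((k j : ℝ≥0∞) ^ a j)⁻¹ else 0

open Classical in
/-- The recursion for truncated multiple zeta values, with the exponents listed from the largest
summation index downwards. -/
noncomputable def nestedSum : List ℕ → ℕ∞ → ℝ≥0∞
  | [], _ => 1
  | a :: m, N => ∑' k : ℕ, if 0 < k ∧ (k : ℕ∞) < N then ((k : ℝ≥0∞) ^ a)⁻¹ * nestedSum m k else 0

theorem strictMono_snoc_iff {r : ℕ} (k : Fin r → ℕ) (x : ℕ) :
    StrictMono (Fin.snoc k x : Fin (r + 1) → ℕ) ↔ StrictMono k ∧ ∀ j, k j < x := by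
  constructor
  · intro h
    refine ⟨fun i j hij => ?_, fun j => ?_⟩
    · simpa using h (Fin.castSucc_lt_castSucc_iff.2 hij)
    · simpa using h (Fin.castSucc_lt_last j)
  · rintro ⟨h, hx⟩ i j hij
    induction j using Fin.lastCases with
    | last =>
      induction i using Fin.lastCases with
      | last => exact absurd hij (lt_irrefl _)
      | cast i => simpa using hx i
    | cast j =>
      induction i using Fin.lastCases with
      | last => exact absurd hij (not_lt.2 (Fin.le_last _))
      | cast i => simpa using h (Fin.castSucc_lt_castSucc_iff.1 hij)

theorem mzvBelow_eq_nestedSum {r : ℕ} (a : Fin r → ℕ) (N : ℕ∞) :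
    mzvBelow a N = nestedSum (List.ofFn a).reverse N := by
  induction r generalizing N with
  | zero =>
    simp only [mzvBelow, List.ofFn_zero, List.reverse_nil, nestedSum]
    rw [tsum_eq_single default (fun b hb => absurd (Subsingleton.elim _ _) hb)]
    rw [if_pos]
    · simp
    · exact ⟨fun i => i.elim0, fun i => i.elim0, fun i => i.elim0⟩
  | succ r ih =>
    rw [List.ofFn_succ', List.concat_eq_append, List.reverse_append, List.reverse_singleton,
      List.singleton_append, nestedSum, mzvBelow, ← (Fin.snocEquiv fun _ => ℕ).tsum_eq,
      ENNReal.tsum_prod']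
    refine tsum_congr fun x => ?_
    rw [← ih, mzvBelow]
    split_ifs with hx
    · rw [← ENNReal.tsum_mul_left]
      refine tsum_congr fun k => ?_
      have hiff : (StrictMono (Fin.snocEquiv (fun _ => ℕ) (x, k)) ∧
          (∀ j, 0 < Fin.snocEquiv (fun _ => ℕ) (x, k) j) ∧
          ∀ j, ((Fin.snocEquiv (fun _ => ℕ) (x, k) j : ℕ) : ℕ∞) < N) ↔
          (StrictMono k ∧ (∀ j, 0 < k j) ∧ ∀ j, (k j : ℕ∞) < x) := by
        change (StrictMono (Fin.snoc k x : Fin (r + 1) → ℕ) ∧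
          (∀ j, 0 < (Fin.snoc k x : Fin (r + 1) → ℕ) j) ∧
          ∀ j, (((Fin.snoc k x : Fin (r + 1) → ℕ) j : ℕ) : ℕ∞) < N) ↔ _
        rw [strictMono_snoc_iff, Fin.forall_fin_succ', Fin.forall_fin_succ']
        simp only [Fin.snoc_castSucc, Fin.snoc_last, Nat.cast_lt]
        constructor
        · rintro ⟨⟨h1, h2⟩, ⟨h3, -⟩, -⟩
          exact ⟨h1, h3, h2⟩
        · rintro ⟨h1, h3, h2⟩
          exact ⟨⟨h1, h2⟩, ⟨h3, hx.1⟩, fun j => (Nat.cast_lt.2 (h2 j)).trans hx.2, hx.2⟩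
      rw [if_congr hiff rfl rfl, mul_ite, mul_zero]
      congr 1
      change ∏ j, (((Fin.snoc k x : Fin (r + 1) → ℕ) j : ℝ≥0∞) ^ a j)⁻¹ = _
      rw [Fin.prod_univ_castSucc, mul_comm]
      simp
    · rw [ENNReal.tsum_eq_zero]
      intro k
      rw [if_neg]
      rintro ⟨-, h1, h2⟩
      refine hx ⟨?_, ?_⟩
      · simpa [Fin.snocEquiv] using h1 (Fin.last r)
      · simpa [Fin.snocEquiv] using h2 (Fin.last r)

theorem mzv_eq_nestedSum (m : List ℕ) : mzv m = (nestedSum m.reverse ⊤).toReal := by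
  have h : nestedSum m.reverse ⊤ = mzvBelow m.get ⊤ := by
    rw [mzvBelow_eq_nestedSum, List.ofFn_get]
  have h1 : mzvBelow m.get ⊤ =
      ∑' k : {k : Fin m.length → ℕ // StrictMono k ∧ ∀ j, 0 < k j},
        ∏ j, ((k.1 j : ℝ≥0∞) ^ m.get j)⁻¹ := by
    rw [mzvBelow]
    refine Eq.trans ?_ (tsum_subtype {k : Fin m.length → ℕ | StrictMono k ∧ ∀ j, 0 < k j}
      fun k => ∏ j, ((k j : ℝ≥0∞) ^ m.get j)⁻¹).symm
    refine tsum_congr fun k => ?_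
    simp [Set.indicator]
  rw [h, h1, ENNReal.tsum_toReal_eq, mzv]
  · refine tsum_congr fun k => ?_
    rw [ENNReal.toReal_prod]
    refine Finset.prod_congr rfl fun j _ => ?_
    simp
  · intro k
    refine ENNReal.prod_ne_top fun j _ => ?_
    have := (k.2.2 j).ne'
    simp [this]

/-! ### Admissible words and the identification of `psi`. -/

/-- The lists of sum `2 * n` which are concatenations of the blocks `[2]` and `[1, 1]`. -/
def blockLists : ℕ → Finset (List ℕ)
  | 0 => {[]}
  | n + 1 => (blockLists n).image (2 :: ·) ∪ (blockLists n).image (1 :: 1 :: ·)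

/-- The word attached to a reversed list of exponents. -/
def revWord (m : List ℕ) : List (Fin 2) := m.flatMap fun a => List.replicate (a - 1) 0 ++ [1]

theorem length_revWord {m : List ℕ} (h : ∀ a ∈ m, 1 ≤ a) : (revWord m).length = m.sum := by
  induction m with
  | nil => rfl
  | cons a m ih =>
    have h1 := h a (by simp)
    have h2 := ih fun b hb => h b (by simp [hb])
    simp only [revWord] at h2
    simp [revWord, h2]
    omega

theorem isAdmissible_cons_cons {x y : Fin 2} {w : List (Fin 2)} (hw : Even w.length) :
    IsAdmissible (x :: y :: w) ↔ y = 1 ∧ IsAdmissible w := by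
  have hmod : ∀ k : ℕ, k + 1 ≡ w.length [MOD 2] ↔ Odd k := by
    intro k
    rw [Nat.ModEq]
    grind
  have hmod' : ∀ k : ℕ, k + 1 ≡ w.length + 1 + 1 [MOD 2] ↔ Odd k := by
    intro k
    rw [Nat.ModEq]
    grind
  constructor
  · intro h
    constructor
    · exact h ⟨1, by simp⟩ ((hmod' 1).2 (by decide))
    · intro k hk
      refine h ⟨k + 2, by simp⟩ ((hmod' _).2 ?_)
      have := (hmod _).1 hk
      grind
  · rintro ⟨rfl, h⟩ ⟨k, hk⟩ hmk
    have hk' := (hmod' k).1 hmk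
    match k, hk, hk' with
    | 0, _, h0 => exact absurd h0 (by decide)
    | 1, _, _ => rfl
    | k + 2, hk, hk' =>
      refine h ⟨k, by simpa using hk⟩ ((hmod k).2 ?_)
      grind

theorem mem_blockLists_iff (n : ℕ) (m : List ℕ) :
    m ∈ blockLists n ↔
      m.sum = 2 * n ∧ (∀ a ∈ m, 1 ≤ a ∧ a ≤ 2) ∧ IsAdmissible (revWord m) := by
  induction n generalizing m with
  | zero =>
    simp only [blockLists, Finset.mem_singleton]
    constructor
    · rintro rfl
      exact ⟨rfl, by simp, fun k => k.elim0⟩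
    · rintro ⟨h1, h2, -⟩
      rcases m with _ | ⟨a, m⟩
      · rfl
      · have := h2 a (by simp)
        simp at h1
        omega
  | succ n ih =>
    simp only [blockLists, Finset.mem_union, Finset.mem_image]
    have key : ∀ t : List ℕ, t.sum = 2 * n → (∀ a ∈ t, 1 ≤ a ∧ a ≤ 2) →
        Even (revWord t).length := by
      intro t h1 h2
      rw [length_revWord fun a ha => (h2 a ha).1, h1]
      exact even_two_mul n
    constructor
    · rintro (⟨t, ht, rfl⟩ | ⟨t, ht, rfl⟩)
      · obtain ⟨h1, h2, h3⟩ := (ih t).1 ht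
        refine ⟨by simp [h1]; ring, by simpa using h2, ?_⟩
        exact (isAdmissible_cons_cons (x := 0) (y := 1) (key t h1 h2)).2 ⟨rfl, h3⟩
      · obtain ⟨h1, h2, h3⟩ := (ih t).1 ht
        refine ⟨by simp [h1]; ring, by simpa using h2, ?_⟩
        exact (isAdmissible_cons_cons (x := 1) (y := 1) (key t h1 h2)).2 ⟨rfl, h3⟩
    · rintro ⟨h1, h2, h3⟩
      rcases m with _ | ⟨a, m⟩
      · simp at h1
      have ha := h2 a (by simp)
      have h2' : ∀ b ∈ m, 1 ≤ b ∧ b ≤ 2 := fun b hb => h2 b (by simp [hb])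
      rw [List.sum_cons] at h1
      obtain rfl | rfl : a = 1 ∨ a = 2 := by omega
      · rcases m with _ | ⟨b, m⟩
        · simp at h1
          omega
        have hb := h2' b (by simp)
        have h2'' : ∀ c ∈ m, 1 ≤ c ∧ c ≤ 2 := fun c hc => h2' c (by simp [hc])
        rw [List.sum_cons] at h1
        obtain rfl | rfl : b = 1 ∨ b = 2 := by omega
        · have hs : m.sum = 2 * n := by omega
          exact Or.inr ⟨m, (ih m).2 ⟨hs, h2'',
            ((isAdmissible_cons_cons (x := 1) (y := 1) (key m hs h2'')).1 h3).2⟩, rfl⟩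
        -- A `1` followed by a `2` gives a word starting `1, 0`; the word has even length, so its
        -- second letter would have to be `1`.
        · exfalso
          have hlen : Even ((1 :: revWord m).length) := by
            rw [List.length_cons, length_revWord fun a ha => (h2'' a ha).1]
            grind
          exact absurd ((isAdmissible_cons_cons (x := 1) (y := 0) hlen).1 h3).1 (by decide)
      · have hs : m.sum = 2 * n := by omega
        exact Or.inl ⟨m, (ih m).2 ⟨hs, h2',
          ((isAdmissible_cons_cons (x := 0) (y := 1) (key m hs h2')).1 h3).2⟩, rfl⟩

theorem psi_eq_sum_blockLists (n : ℕ) :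
    psi (2 * n + 2) = ∑ m ∈ blockLists n, (nestedSum (2 :: m) ⊤).toReal := by
  classical
  rw [psi, if_neg (by omega)]
  simp_rw [mzv_eq_nestedSum]
  have hsum : ∀ m ∈ blockLists n, (m.reverse ++ [2]).sum = 2 * n + 2 := by
    intro m hm
    simp [((mem_blockLists_iff n m).1 hm).1]
  refine (Finset.sum_bij (fun m hm => (⟨m.reverse ++ [2], ?_, hsum m hm⟩ : Composition _))
    ?_ ?_ ?_ ?_).symm
  · intro i hi
    have h := ((mem_blockLists_iff n m).1 hm).2.1
    simp only [List.mem_append, List.mem_reverse, List.mem_singleton] at hi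
    rcases hi with hi | rfl
    · exact (h i hi).1
    · norm_num
  · intro m hm
    obtain ⟨h1, h2, h3⟩ := (mem_blockLists_iff n m).1 hm
    simp only [Finset.mem_filter, Finset.mem_univ, true_and]
    refine ⟨by simp, ?_, ?_⟩
    · intro a ha
      simp only [List.mem_append, List.mem_reverse, List.mem_singleton] at ha
      rcases ha with ha | rfl
      · exact (h2 a ha).2
      · norm_num
    · have h4 : 2 :: m ∈ blockLists (n + 1) := by
        simp only [blockLists, Finset.mem_union, Finset.mem_image]
        exact Or.inl ⟨m, hm, rfl⟩
      have h5 := ((mem_blockLists_iff _ _).1 h4).2.2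
      simpa [word, revWord] using h5
  · intro m hm m' hm' h
    have := congrArg Composition.blocks h
    simpa using this
  · intro c hc
    simp only [Finset.mem_filter, Finset.mem_univ, true_and] at hc
    obtain ⟨h1, h2, h3⟩ := hc
    obtain ⟨t, ht⟩ := List.getLast?_eq_some_iff.1 h1
    have h4 : 2 :: t.reverse ∈ blockLists (n + 1) := by
      rw [mem_blockLists_iff]
      refine ⟨?_, ?_, ?_⟩
      · have := c.blocks_sum
        rw [ht] at this
        simp at this ⊢
        omega
      · intro a ha
        have : a ∈ c.blocks := by
          rw [ht]
          simpa [or_comm] using ha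
        exact ⟨c.blocks_pos this, h2 a this⟩
      · rw [ht] at h3
        simpa [word, revWord] using h3
    have h5 : t.reverse ∈ blockLists n := by
      simpa [blockLists] using h4
    refine ⟨t.reverse, h5, ?_⟩
    ext1
    simp [ht]
  · intro m hm
    simp

theorem tsum_pos_eq_tsum_succ (f : ℕ → ℝ≥0∞) (hf : f 0 = 0) : ∑' k, f k = ∑' k, f (k + 1) := by
  rw [tsum_eq_zero_add' ENNReal.summable, hf, zero_add]

theorem nestedSum_cons_top (a : ℕ) (m : List ℕ) :
    nestedSum (a :: m) ⊤ =
      ∑' j : ℕ, (((j + 1 : ℕ) : ℝ≥0∞) ^ a)⁻¹ * nestedSum m ((j + 1 : ℕ) : ℕ∞) := by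
  rw [nestedSum, tsum_pos_eq_tsum_succ _ (by simp)]
  refine tsum_congr fun j => ?_
  rw [if_pos ⟨j.succ_pos, ENat.natCast_lt_top _⟩]

theorem nestedSum_cons_succ (a : ℕ) (m : List ℕ) (K : ℕ) :
    nestedSum (a :: m) ((K + 1 : ℕ) : ℕ∞) = ∑ j ∈ Finset.range K,
      (((j + 1 : ℕ) : ℝ≥0∞) ^ a)⁻¹ * nestedSum m ((j + 1 : ℕ) : ℕ∞) := by
  rw [nestedSum, tsum_pos_eq_tsum_succ _ (by simp), tsum_eq_sum (s := Finset.range K)]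
  · refine Finset.sum_congr rfl fun j hj => ?_
    rw [if_pos ⟨j.succ_pos, Nat.cast_lt.2 (by simpa using hj)⟩]
  · intro j hj
    rw [if_neg]
    rintro ⟨-, h⟩
    rw [Nat.cast_lt] at h
    simp at hj
    omega

theorem sum_blockLists_succ (n : ℕ) (f : List ℕ → ℝ≥0∞) :
    ∑ m ∈ blockLists (n + 1), f m =
      ∑ m ∈ blockLists n, f (2 :: m) + ∑ m ∈ blockLists n, f (1 :: 1 :: m) := by
  rw [blockLists, Finset.sum_union, Finset.sum_image, Finset.sum_image]
  · intro a _ b _ h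
    simpa using h
  · intro a _ b _ h
    simpa using h
  · rw [Finset.disjoint_left]
    intro t ht ht'
    simp only [Finset.mem_image] at ht ht'
    obtain ⟨a, -, rfl⟩ := ht
    obtain ⟨b, -, h⟩ := ht'
    simp at h

theorem inv_natCast_pow_eq_ofReal (j a : ℕ) :
    (((j + 1 : ℕ) : ℝ≥0∞) ^ a)⁻¹ = ENNReal.ofReal (1 / ((j : ℝ) + 1) ^ a) := by
  rw [one_div, ENNReal.ofReal_inv_of_pos (by positivity), ENNReal.ofReal_pow (by positivity),
    ← ENNReal.ofReal_natCast]
  push_cast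
  rfl

/-- A leading block `(2)` gives two equal indices and a block `(1,1)` two strictly ordered ones;
together they give `≤`, while different blocks stay separated by `<`. This is the alternation built
into `harm`. -/
theorem sum_blockLists_nestedSum (n k : ℕ) :
    ∑ m ∈ blockLists n, nestedSum m ((k + 1 : ℕ) : ℕ∞) =
      ENNReal.ofReal (((k : ℝ) + 1) * harm (2 * n) k) := by
  induction n generalizing k with
  | zero =>
    have : (k : ℝ) + 1 ≠ 0 := by positivity
    simp [blockLists, nestedSum, harm, this]
  | succ n ih =>
    have hmul : ∀ (a j : ℕ) , ∑ m ∈ blockLists n,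
        (((j + 1 : ℕ) : ℝ≥0∞) ^ (a + 1))⁻¹ * nestedSum m ((j + 1 : ℕ) : ℕ∞) =
          ENNReal.ofReal (harm (2 * n) j / ((j : ℝ) + 1) ^ a) := by
      intro a j
      rw [← Finset.mul_sum, ih, inv_natCast_pow_eq_ofReal, ← ENNReal.ofReal_mul (by positivity)]
      congr 1
      field_simp
      ring
    rw [sum_blockLists_succ]
    simp_rw [nestedSum_cons_succ]
    rw [Finset.sum_comm, Finset.sum_comm (s := blockLists n), ← Finset.sum_add_distrib]
    have hterm : ∀ j : ℕ, (∑ m ∈ blockLists n,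
          (((j + 1 : ℕ) : ℝ≥0∞) ^ 2)⁻¹ * nestedSum m ((j + 1 : ℕ) : ℕ∞)) +
        (∑ m ∈ blockLists n, (((j + 1 : ℕ) : ℝ≥0∞) ^ 1)⁻¹ * ∑ i ∈ Finset.range j,
          (((i + 1 : ℕ) : ℝ≥0∞) ^ 1)⁻¹ * nestedSum m ((i + 1 : ℕ) : ℕ∞)) =
        ENNReal.ofReal (harm (2 * n + 1) j) := by
      intro j
      rw [hmul 1 j, ← Finset.mul_sum, Finset.sum_comm]
      simp_rw [hmul 0]
      rw [← ENNReal.ofReal_sum_of_nonneg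
          (fun i _ => div_nonneg (harm_nonneg _ _) (by positivity)),
        inv_natCast_pow_eq_ofReal, ← ENNReal.ofReal_mul (by positivity),
        ← ENNReal.ofReal_add (div_nonneg (harm_nonneg _ _) (by positivity))
          (mul_nonneg (by positivity)
            (Finset.sum_nonneg fun i _ => div_nonneg (harm_nonneg _ _) (by positivity)))]
      congr 1
      simp only [harm, even_two_mul, if_true, Finset.sum_range_succ, pow_zero, div_one, pow_one]
      ring
    simp_rw [hterm]
    rw [← ENNReal.ofReal_sum_of_nonneg (fun i _ => harm_nonneg _ _)]
    congr 1
    rw [show 2 * (n + 1) = 2 * n + 1 + 1 by ring]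
    have : ¬ Even (2 * n + 1) := by simp
    rw [harm, if_neg this, add_zero]
    field_simp

theorem psi_eq_hilb {m : ℕ} (hm : Even m) : psi (m + 2) = hilb m 0 := by
  obtain ⟨n, rfl⟩ := hm
  rw [← two_mul]
  have hnn : ∀ j : ℕ, 0 ≤ harm (2 * n) j / ((j : ℝ) + 1 + (0 : ℕ)) :=
    fun j => div_nonneg (harm_nonneg _ _) (by positivity)
  have h : ∑ m ∈ blockLists n, nestedSum (2 :: m) ⊤ = ENNReal.ofReal (hilb (2 * n) 0) := by
    simp_rw [nestedSum_cons_top]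
    rw [← Summable.tsum_finsetSum fun _ _ => ENNReal.summable, hilb,
      ENNReal.ofReal_tsum_of_nonneg hnn (summable_harm_div _ _)]
    refine tsum_congr fun j => ?_
    rw [← Finset.mul_sum, sum_blockLists_nestedSum, inv_natCast_pow_eq_ofReal,
      ← ENNReal.ofReal_mul (by positivity)]
    congr 1
    push_cast
    field_simp
    ring
  rw [psi_eq_sum_blockLists, ← ENNReal.toReal_sum, h]
  · exact ENNReal.toReal_ofReal (tsum_nonneg hnn)
  -- Finiteness of each zeta value comes for free from finiteness of the total.
  · exact ENNReal.sum_ne_top.1 (by rw [h]; exact ENNReal.ofReal_ne_top)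

/-! ### The numbers `beta` as coefficients of moments. -/

theorem beta_zero_right (n : ℕ) : beta n 0 = 0 := by
  rcases n with _ | _ | _ | n <;> simp [beta]

theorem beta_eq_zero_of_parity {l m : ℕ} (h : ¬ m ≡ l + 1 [MOD 2]) : beta (l + 2) m = 0 := by
  rcases l with _ | l
  · simp only [beta]
    rw [if_neg]
    rintro rfl
    exact h rfl
  · simp only [beta]
    rw [if_neg fun hm => h hm.2.2]

/-- The parity condition in `beta` can be dropped: in the wrong parity every summand already
vanishes. -/
theorem beta_succ {l m : ℕ} (h : m ≤ l + 1) : beta (l + 3) (m + 1) =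
    ∑ n ∈ Finset.range (l + 2 - m) with Even n, psi n * beta (l + 2) (m + n) := by
  rw [beta]
  split_ifs with hm
  · rw [show l + 2 - (m + 1) + 1 = l + 2 - m by omega]
    rfl
  · rw [Finset.sum_eq_zero]
    intro n hn
    simp only [Finset.mem_filter] at hn
    rw [beta_eq_zero_of_parity, mul_zero]
    intro hmod
    refine hm ⟨by omega, by omega, ?_⟩
    have := hn.2
    rw [Nat.ModEq] at hmod ⊢
    grind

/-- The expansion, with coefficients `β`, of the moments of `G (l + 1) 1`. -/
noncomputable def moment (l k : ℕ) : ℝ :=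
  ∑ m ∈ Finset.range (l + 1), beta (l + 2) (m + 1) * harm m k

theorem moment_zero (k : ℕ) : moment 0 k = 1 / ((k : ℝ) + 1) := by
  simp [moment, beta, harm]

theorem hasSum_moment_div (l c : ℕ) : HasSum (fun j : ℕ => moment l j / ((j : ℝ) + 1 + c))
    (∑ m ∈ Finset.range (l + 1), beta (l + 2) (m + 1) * hilb m c) := by
  refine (hasSum_sum fun m _ => (hasSum_hilb m c).mul_left (beta (l + 2) (m + 1))).congr_fun
    fun j => ?_
  rw [moment, Finset.sum_div]
  exact Finset.sum_congr rfl fun m _ => by ring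

/-- Insert `hilb_succ_eq_sum` with `p = psi` and collect the coefficient of each `harm m`. Both
sides become sums over a triangle, by rows or by diagonals; the extra diagonal vanishes since `beta
(l + 2) 0 = 0`. -/
theorem hasSum_moment_succ (l k : ℕ) :
    HasSum (fun j : ℕ => moment l j / ((j : ℝ) + 1 + (k + 1 : ℕ))) (moment (l + 1) k) := by
  convert hasSum_moment_div l (k + 1) using 1
  set F : ℕ → ℕ → ℝ := fun m n =>
    if Even n then psi n * beta (l + 2) (m + n) * harm m k else 0 with hF
  have h1 : moment (l + 1) k =
      ∑ m ∈ Finset.range (l + 2), ∑ n ∈ Finset.range (l + 2 - m), F m n := by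
    rw [moment]
    refine Finset.sum_congr rfl fun m hm => ?_
    rw [Finset.mem_range] at hm
    rw [beta_succ (by omega), Finset.sum_mul, Finset.sum_filter]
  have h2 : ∀ m, beta (l + 2) (m + 1) * hilb m (k + 1) =
      ∑ n ∈ Finset.range (m + 2), F n (m + 1 - n) := by
    intro m
    rw [hilb_succ_eq_sum psi (by simp [psi]) fun m hm => psi_eq_hilb hm, Finset.mul_sum,
      Finset.sum_filter, ← Finset.sum_flip]
    refine Finset.sum_congr rfl fun n hn => ?_
    rw [Finset.mem_range] at hn
    simp only [hF]
    rw [show m + 1 - (m + 1 - n) = n by omega, show n + (m + 1 - n) = m + 1 by omega]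
    split_ifs
    · ring
    · rfl
  rw [h1, Finset.sum_congr rfl fun m _ => h2 m, ← Finset.sum_range_diag_flip,
    Finset.sum_range_succ']
  simp [hF, beta_zero_right]

theorem moment_nonneg (l k : ℕ) : 0 ≤ moment l k := by
  induction l generalizing k with
  | zero => rw [moment_zero]; positivity
  | succ l ih => exact (hasSum_moment_succ l k).nonneg fun j => div_nonneg (ih j) (by positivity)

theorem sum_beta_mul_hilb_zero {l : ℕ} (hl : Even l) :
    ∑ m ∈ Finset.range (l + 1), beta (l + 2) (m + 1) * hilb m 0 =
      ∑ m ∈ Finset.Icc 1 (l + 1) with Odd m, beta (l + 2) m * psi (m + 1) := by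
  rw [Finset.sum_filter, Finset.range_eq_Ico]
  refine (Finset.sum_Ico_add' (fun m => beta (l + 2) m * hilb (m - 1) 0) 0 (l + 1) 1).trans ?_
  rw [show Finset.Ico (0 + 1) (l + 1 + 1) = Finset.Icc 1 (l + 1) by ext; simp]
  refine Finset.sum_congr rfl fun m hm => ?_
  obtain ⟨m, rfl⟩ : ∃ n, m = n + 1 := ⟨m - 1, by rw [Finset.mem_Icc] at hm; omega⟩
  split_ifs with h
  · rw [psi_eq_hilb (by grind)]
    rfl
  · rw [beta_eq_zero_of_parity, zero_mul]
    rw [Nat.ModEq]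
    grind

/-- For `m ≥ 1` one of the two factors vanishes: `harm m 0` for even `m`, the coefficient for odd
`m`. -/
theorem moment_zero_right {l : ℕ} (hl : Even l) : moment l 0 = beta (l + 2) 1 := by
  rw [moment, Finset.sum_range_succ', Finset.sum_eq_zero]
  · simp [harm]
  · intro m _
    rcases Nat.even_or_odd m with hm | hm
    · rw [beta_eq_zero_of_parity, zero_mul]
      rw [Nat.ModEq]
      grind
    · rw [harm_succ_zero_of_odd hm, mul_zero]

/-! ### Termwise integration of nonnegative series. -/

open MeasureTheory Set

/-- Monotone convergence for a series of nonnegative integrable functions. -/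
theorem integrable_and_integral_eq_of_hasSum {α : Type*} [MeasurableSpace α] {μ : Measure α}
    {F : ℕ → α → ℝ} {f : α → ℝ} {S : ℝ} (hF : ∀ n, Integrable (F n) μ)
    (hF0 : ∀ n, 0 ≤ᵐ[μ] F n) (hf : ∀ᵐ x ∂μ, HasSum (fun n => F n x) (f x))
    (hS : HasSum (fun n => ∫ x, F n x ∂μ) S) : Integrable f μ ∧ ∫ x, f x ∂μ = S := by
  have hF0' : ∀ᵐ x ∂μ, ∀ n, 0 ≤ F n x := ae_all_iff.2 hF0
  have hf0 : 0 ≤ᵐ[μ] f := by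
    filter_upwards [hF0', hf] with x h1 h2 using h2.nonneg h1
  have hmeas : AEStronglyMeasurable f μ := by
    refine aestronglyMeasurable_of_tendsto_ae atTop
      (f := fun N x => ∑ n ∈ Finset.range N, F n x) (fun N => ?_) ?_
    · exact (integrable_finsetSum _ fun n _ => hF n).aestronglyMeasurable
    · filter_upwards [hf] with x hx using hx.tendsto_sum_nat
  constructor
  · refine ⟨hmeas, ?_⟩
    rw [hasFiniteIntegral_iff_ofReal hf0]
    have h1 : ∫⁻ x, ENNReal.ofReal (f x) ∂μ = ∫⁻ x, ∑' n, ENNReal.ofReal (F n x) ∂μ := by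
      refine lintegral_congr_ae ?_
      filter_upwards [hF0', hf] with x h2 h3
      rw [← h3.tsum_eq, ENNReal.ofReal_tsum_of_nonneg h2 h3.summable]
    rw [h1, lintegral_tsum fun n => (hF n).aestronglyMeasurable.aemeasurable.ennreal_ofReal]
    simp_rw [← ofReal_integral_eq_lintegral_ofReal (hF _) (hF0 _)]
    rw [← ENNReal.ofReal_tsum_of_nonneg (fun n => integral_nonneg_of_ae (hF0 n)) hS.summable]
    exact ENNReal.ofReal_lt_top
  · have h1 : ∀ n, ∫ x, ‖F n x‖ ∂μ = ∫ x, F n x ∂μ := by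
      intro n
      refine integral_congr_ae ?_
      filter_upwards [hF0 n] with x hx using Real.norm_of_nonneg hx
    have h2 := hasSum_integral_of_summable_integral_norm hF (by simpa only [h1] using hS.summable)
    rw [← h2.unique hS]
    refine integral_congr_ae ?_
    filter_upwards [hf] with x hx using hx.tsum_eq.symm

theorem integrableOn_Ioo_pow (n : ℕ) : IntegrableOn (fun t : ℝ => t ^ n) (Ioo 0 1) :=
  ((continuous_pow n).integrableOn_Icc (a := 0) (b := 1)).mono_set Ioo_subset_Icc_self

theorem integral_Ioo_pow (n : ℕ) : ∫ t in Ioo (0 : ℝ) 1, t ^ n = 1 / ((n : ℝ) + 1) := by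
  rw [← integral_Ioc_eq_integral_Ioo, ← intervalIntegral.integral_of_le zero_le_one,
    integral_pow]
  simp

theorem integral_pow_mul_powerSeries {f : ℝ → ℝ} {a : ℕ → ℝ} (ha : ∀ j, 0 ≤ a j) {d : ℕ}
    (hf : ∀ t ∈ Ioo (0 : ℝ) 1, HasSum (fun j => a j * t ^ (j + d)) (f t)) {p : ℕ} {S : ℝ}
    (hS : HasSum (fun j => a j / ((j : ℝ) + 1 + (d + p : ℕ))) S) :
    IntegrableOn (fun t => t ^ p * f t) (Ioo 0 1) ∧ ∫ t in Ioo (0 : ℝ) 1, t ^ p * f t = S := by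
  refine integrable_and_integral_eq_of_hasSum (F := fun j t => a j * t ^ (j + d + p))
    (fun j => (integrableOn_Ioo_pow _).const_mul _) (fun j => ?_) ?_ ?_
  · filter_upwards [ae_restrict_mem measurableSet_Ioo] with t ht
    exact mul_nonneg (ha j) (pow_nonneg ht.1.le _)
  · filter_upwards [ae_restrict_mem measurableSet_Ioo] with t ht
    refine ((hf t ht).mul_left (t ^ p)).congr_fun fun j => ?_
    ring
  · refine hS.congr_fun fun j => ?_
    rw [integral_const_mul, integral_Ioo_pow]
    push_cast
    ring

theorem hasSum_integral_geometric_mul {f : ℝ → ℝ} (hf0 : ∀ t ∈ Ioo (0 : ℝ) 1, 0 ≤ f t)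
    (hf : IntegrableOn f (Ioo 0 1)) (d : ℕ) {y : ℝ} (hy : y ∈ Ioo (0 : ℝ) 1) :
    HasSum (fun n => (∫ t in Ioo (0 : ℝ) 1, t ^ (n + d) * f t) * y ^ (n + d))
      (∫ t in Ioo (0 : ℝ) 1, (t * y) ^ d / (1 - t * y) * f t) := by
  have hint : ∀ n, IntegrableOn (fun t => t ^ n * f t) (Ioo 0 1) := by
    intro n
    refine Integrable.mono' hf
      ((continuous_pow n).aestronglyMeasurable.mul hf.aestronglyMeasurable) ?_
    filter_upwards [ae_restrict_mem measurableSet_Ioo] with t ht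
    rw [Real.norm_of_nonneg (mul_nonneg (pow_nonneg ht.1.le _) (hf0 t ht))]
    exact mul_le_of_le_one_left (hf0 t ht) (pow_le_one₀ ht.1.le ht.2.le)
  have hle : ∀ n, ∫ t in Ioo (0 : ℝ) 1, t ^ n * f t ≤ ∫ t in Ioo (0 : ℝ) 1, f t := by
    intro n
    refine setIntegral_mono_on (hint n) hf measurableSet_Ioo fun t ht => ?_
    exact mul_le_of_le_one_left (hf0 t ht) (pow_le_one₀ ht.1.le ht.2.le)
  have hnn : ∀ n, 0 ≤ ∫ t in Ioo (0 : ℝ) 1, t ^ n * f t := fun n =>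
    setIntegral_nonneg measurableSet_Ioo fun t ht => mul_nonneg (pow_nonneg ht.1.le _) (hf0 t ht)
  have hsum : Summable fun n => (∫ t in Ioo (0 : ℝ) 1, t ^ (n + d) * f t) * y ^ (n + d) := by
    refine Summable.of_nonneg_of_le (fun n => mul_nonneg (hnn _) (pow_nonneg hy.1.le _))
      (fun n => mul_le_mul_of_nonneg_right (hle _) (pow_nonneg hy.1.le _)) ?_
    exact ((summable_nat_add_iff d).2 (summable_geometric_of_lt_one hy.1.le hy.2)).mul_left _
  have := (integrable_and_integral_eq_of_hasSum (μ := volume.restrict (Ioo (0 : ℝ) 1))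
    (F := fun n t => t ^ (n + d) * f t * y ^ (n + d))
    (f := fun t => (t * y) ^ d / (1 - t * y) * f t) (fun n => (hint _).mul_const _)
    (fun n => ?_) ?_ (hsum.hasSum.congr_fun fun n => integral_mul_const _ _)).2
  · rw [this]
    exact hsum.hasSum
  · filter_upwards [ae_restrict_mem measurableSet_Ioo] with t ht
    exact mul_nonneg (mul_nonneg (pow_nonneg ht.1.le _) (hf0 t ht)) (pow_nonneg hy.1.le _)
  · filter_upwards [ae_restrict_mem measurableSet_Ioo] with t ht
    have h1 : t * y < 1 := mul_lt_one_of_nonneg_of_lt_one_left ht.1.le ht.2 hy.2.le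
    have h2 := (hasSum_geometric_of_lt_one (mul_nonneg ht.1.le hy.1.le) h1).mul_left
      ((t * y) ^ d * f t)
    rw [← div_eq_mul_inv, mul_div_right_comm] at h2
    refine h2.congr_fun fun n => ?_
    rw [mul_pow, mul_pow]
    ring

/-! ### Moments and integrals of `G`. -/

/-- The lowest exponent in the expansion of `kernel l`. -/
def kernelOrder (l : ℕ) : ℕ := if Odd l then 0 else 1

theorem kernelOrder_add_succ (l : ℕ) : kernelOrder l + kernelOrder (l + 1) = 1 := by
  unfold kernelOrder
  split_ifs <;> grind

theorem G_add_two_one (l : ℕ) (y : ℝ) : G (l + 2) 1 y = ∫ t in Ioo (0 : ℝ) 1,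
    (t * y) ^ kernelOrder (l + 1) / (1 - t * y) * G (l + 1) 1 t := by
  rw [G, intervalIntegral.integral_of_le zero_le_one, integral_Ioc_eq_integral_Ioo]
  refine setIntegral_congr_fun measurableSet_Ioo fun t _ => ?_
  simp only [kernel, kernelOrder]
  split_ifs <;> simp

theorem hasSum_G_add_two {l : ℕ} {a : ℕ → ℝ} (h0 : ∀ t ∈ Ioo (0 : ℝ) 1, 0 ≤ G (l + 1) 1 t)
    (hint : IntegrableOn (G (l + 1) 1) (Ioo 0 1))
    (ha : ∀ k, ∫ t in Ioo (0 : ℝ) 1, t ^ (k + kernelOrder (l + 1)) * G (l + 1) 1 t = a k)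
    {t : ℝ} (ht : t ∈ Ioo (0 : ℝ) 1) :
    HasSum (fun j => a j * t ^ (j + kernelOrder (l + 1))) (G (l + 2) 1 t) := by
  have := hasSum_integral_geometric_mul h0 hint (kernelOrder (l + 1)) ht
  rw [← G_add_two_one] at this
  simpa only [ha] using this

theorem G_moments (l : ℕ) : (∀ t ∈ Ioo (0 : ℝ) 1, 0 ≤ G (l + 1) 1 t) ∧
    IntegrableOn (G (l + 1) 1) (Ioo 0 1) ∧
    ∀ k, ∫ t in Ioo (0 : ℝ) 1, t ^ (k + kernelOrder (l + 1)) * G (l + 1) 1 t = moment l k := by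
  induction l with
  | zero =>
    refine ⟨fun t _ => by simp [G], by simp [G], fun k => ?_⟩
    simp only [G, mul_one, kernelOrder, zero_add, odd_one, if_true, add_zero]
    rw [integral_Ioo_pow, moment_zero]
  | succ l ih =>
    obtain ⟨h1, h2, h3⟩ := ih
    have h4 : ∀ t ∈ Ioo (0 : ℝ) 1, HasSum
        (fun j => moment l j * t ^ (j + kernelOrder (l + 1))) (G (l + 1 + 1) 1 t) :=
      fun t ht => hasSum_G_add_two h1 h2 h3 ht
    refine ⟨fun t ht => ?_, ?_, fun k => ?_⟩
    · exact (h4 t ht).nonneg fun j => mul_nonneg (moment_nonneg l j) (pow_nonneg ht.1.le _)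
    · simpa using (integral_pow_mul_powerSeries (p := 0) (moment_nonneg l) h4
        (hasSum_moment_div l _)).1
    · refine (integral_pow_mul_powerSeries (moment_nonneg l) h4 ?_).2
      -- Consecutive kernels have orders `0` and `1` in some order, so the exponent shift is always
      -- `k + 1`.
      have h5 := kernelOrder_add_succ (l + 1)
      rw [show kernelOrder (l + 1) + (k + kernelOrder (l + 1 + 1)) = k + 1 by omega]
      exact hasSum_moment_succ l k

theorem integral_G (l : ℕ) : ∫ t in (0 : ℝ)..1, G (l + 2) 1 t =
    ∑ m ∈ Finset.range (l + 1), beta (l + 2) (m + 1) * hilb m (kernelOrder (l + 1)) := by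
  obtain ⟨h1, h2, h3⟩ := G_moments l
  rw [intervalIntegral.integral_of_le zero_le_one, integral_Ioc_eq_integral_Ioo]
  simpa using (integral_pow_mul_powerSeries (p := 0) (moment_nonneg l)
    (fun t ht => hasSum_G_add_two h1 h2 h3 ht) (hasSum_moment_div l _)).2

end XiIntegrals

theorem mainTheorem5 (l : ℕ) (hl : 1 ≤ l) :
    IntervalIntegrable (fun x : ℝ => XiIntegrals.G (l + 1) 1 x) MeasureTheory.volume 0 1 ∧
    (Odd l → ∫ x in (0 : ℝ)..1, XiIntegrals.G (l + 1) 1 x =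
      ∑ m ∈ Finset.Icc 1 l with Odd m, XiIntegrals.beta (l + 1) m * XiIntegrals.psi (m + 1)) ∧
    (Even l → ∫ x in (0 : ℝ)..1, XiIntegrals.G (l + 1) 1 x = XiIntegrals.beta (l + 2) 1) := by
  obtain ⟨l, rfl⟩ : ∃ n, l = n + 1 := ⟨l - 1, by omega⟩
  refine ⟨?_, fun h => ?_, fun h => ?_⟩
  · rw [intervalIntegrable_iff_integrableOn_Ioo_of_le zero_le_one]
    exact (XiIntegrals.G_moments (l + 1)).2.1
  · rw [XiIntegrals.integral_G, XiIntegrals.kernelOrder, if_pos h]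
    exact XiIntegrals.sum_beta_mul_hilb_zero (by grind)
  · rw [XiIntegrals.integral_G, XiIntegrals.kernelOrder, if_neg (by grind),
      ← XiIntegrals.moment_zero_right h]
    -- The kernel order is `1` here, so the integral is the entry `k = 0` of the next moment vector.
    exact (XiIntegrals.hasSum_moment_div l 1).unique (XiIntegrals.hasSum_moment_succ l 0)
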